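/- Let $\Bbbk$ be a field of characteristic zero, let $m \ge 0$ and $n \ge 1$ be integers, let $\mathfrak{h}_m$ be the $(2m+1)$-dimensional Heisenberg Lie algebra over $\Bbbk$, with basis $X_1,\dots,X_m,Y_1,\dots,Y_m,Z$ and with $[X_i,Y_i]=Z=-[Y_i,X_i]$ $(1\le i\le m)$ as the only non-zero brackets of basis elements, and let $\mathfrak{a}_n$ be the $n$-dimensional abelian Lie algebra over $\Bbbk$. For a finite-dimensional Lie algebra $\mathfrak{g}$ over $\Bbbk$, let $\mu(\mathfrak{g})$ be the minimal dimension of a finite-dimensional faithful representation of $\mathfrak{g}$ over $\Bbbk$, and, for $\mathfrak{g}$ nilpotent, let $\mu_{nil}(\mathfrak{g})$ be the minimal dimension of a finite-dimensional faithful nilrepresentation of $\mathfrak{g}$, that is, a faithful representation $(\pi,V)$ such that $\pi(X)$ is a nilpotent endomorphism of $V$ for every $X\in\mathfrak{g}$. Then $$\mu_{nil}(\mathfrak{h}_m\oplus\mathfrak{a}_n)=m+\left\lceil 2\sqrt{n+1}\,\right\rceil\qquad\text{and}\qquad \mu(\mathfrak{h}_m\oplus\mathfrak{a}_n)=m+\left\lceil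 2\sqrt{n}\,\right\rceil .$$ -/

import Mathlib

universe u

/-- The Heisenberg Lie algebra of dimension `2m + 1` over `K`. The element with components
`x, y, z` stands for `∑ xᵢ Xᵢ + ∑ yᵢ Yᵢ + z Z`, where `X₁, …, Xₘ, Y₁, …, Yₘ, Z` is the standard
basis. -/
@[ext]
structure HeisenbergLie (K : Type u) (m : ℕ) : Type u where
  x : Fin m → K
  y : Fin m → K
  z : K

namespace HeisenbergLie

/-- The coordinates of an element of the Heisenberg Lie algebra. -/
def equivProd (K : Type u) (m : ℕ) : HeisenbergLie K m ≃ (Fin m → K) × (Fin m → K) × K where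
  toFun a := (a.x, a.y, a.z)
  invFun p := ⟨p.1, p.2.1, p.2.2⟩
  left_inv _ := rfl
  right_inv _ := rfl

variable {K : Type u} [Field K] {m : ℕ}

/-- Addition is componentwise. -/
instance : AddCommGroup (HeisenbergLie K m) := (equivProd K m).addCommGroup

/-- Scalar multiplication is componentwise. -/
instance : Module K (HeisenbergLie K m) := (equivProd K m).module K

/-- The bracket determined by `⁅Xᵢ, Yᵢ⁆ = Z = -⁅Yᵢ, Xᵢ⁆`, all other brackets of basis vectors
being zero. -/
instance : Bracket (HeisenbergLie K m) (HeisenbergLie K m) :=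
  ⟨fun a b => ⟨0, 0, ∑ i, (a.x i * b.y i - a.y i * b.x i)⟩⟩

@[simp] theorem add_x (a b : HeisenbergLie K m) : (a + b).x = a.x + b.x := rfl
@[simp] theorem add_y (a b : HeisenbergLie K m) : (a + b).y = a.y + b.y := rfl
@[simp] theorem add_z (a b : HeisenbergLie K m) : (a + b).z = a.z + b.z := rfl
@[simp] theorem zero_x : (0 : HeisenbergLie K m).x = 0 := rfl
@[simp] theorem zero_y : (0 : HeisenbergLie K m).y = 0 := rfl
@[simp] theorem zero_z : (0 : HeisenbergLie K m).z = 0 := rfl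
@[simp] theorem smul_x (t : K) (a : HeisenbergLie K m) : (t • a).x = t • a.x := rfl
@[simp] theorem smul_y (t : K) (a : HeisenbergLie K m) : (t • a).y = t • a.y := rfl
@[simp] theorem smul_z (t : K) (a : HeisenbergLie K m) : (t • a).z = t * a.z := rfl
@[simp] theorem lie_x (a b : HeisenbergLie K m) : ⁅a, b⁆.x = 0 := rfl
@[simp] theorem lie_y (a b : HeisenbergLie K m) : ⁅a, b⁆.y = 0 := rfl
@[simp] theorem lie_z (a b : HeisenbergLie K m) :
    ⁅a, b⁆.z = ∑ i, (a.x i * b.y i - a.y i * b.x i) := rfl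

instance : LieRing (HeisenbergLie K m) where
  add_lie a b c := by
    ext
    · simp
    · simp
    · simp only [lie_z, add_x, add_y, add_z, Pi.add_apply, ← Finset.sum_add_distrib]
      exact Finset.sum_congr rfl fun i _ => by ring
  lie_add a b c := by
    ext
    · simp
    · simp
    · simp only [lie_z, add_x, add_y, add_z, Pi.add_apply, ← Finset.sum_add_distrib]
      exact Finset.sum_congr rfl fun i _ => by ring
  lie_self a := by
    ext
    · simp
    · simp
    · simp only [lie_z, zero_z]
      exact Finset.sum_eq_zero fun i _ => by ring
  leibniz_lie a b c := by
    ext <;> simp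

instance : LieAlgebra K (HeisenbergLie K m) where
  lie_smul t a b := by
    ext
    · simp
    · simp
    · simp only [lie_z, smul_x, smul_y, smul_z, Pi.smul_apply, smul_eq_mul, Finset.mul_sum]
      exact Finset.sum_congr rfl fun i _ => by ring

end HeisenbergLie

/-- The abelian Lie algebra of dimension `n` over `K`. -/
def AbelianLie (K : Type u) (n : ℕ) : Type u := Fin n → K

namespace AbelianLie

variable {K : Type u} [Field K] {n : ℕ}

instance : AddCommGroup (AbelianLie K n) := inferInstanceAs (AddCommGroup (Fin n → K))

instance : Module K (AbelianLie K n) := inferInstanceAs (Module K (Fin n → K))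

instance : Bracket (AbelianLie K n) (AbelianLie K n) := ⟨fun _ _ => 0⟩

theorem bracket_def (a b : AbelianLie K n) : ⁅a, b⁆ = 0 := rfl

instance : LieRing (AbelianLie K n) where
  add_lie a b c := by simp [bracket_def]
  lie_add a b c := by simp [bracket_def]
  lie_self a := rfl
  leibniz_lie a b c := by simp [bracket_def]

instance : LieAlgebra K (AbelianLie K n) where
  lie_smul t a b := by simp [bracket_def]

end AbelianLie

section Representations

attribute [local instance 100] LieRing.ofAssociativeRing

/-- The set of dimensions of the finite-dimensional faithful representations of a Lie algebra `L`
over `K`. -/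
def faithfulRepDims (K L : Type u) [Field K] [LieRing L] [LieAlgebra K L] : Set ℕ :=
  {d | ∃ (V : Type u) (_ : AddCommGroup V) (_ : Module K V) (π : L →ₗ⁅K⁆ Module.End K V),
    Module.Finite K V ∧ Module.finrank K V = d ∧ Function.Injective π}

/-- The set of dimensions of the finite-dimensional faithful nilrepresentations of a Lie algebra
`L` over `K`, i.e. of the faithful representations in which every element of `L` acts by a
nilpotent endomorphism. -/
def faithfulNilrepDims (K L : Type u) [Field K] [LieRing L] [LieAlgebra K L] : Set ℕ :=
  {d | ∃ (V : Type u) (_ : AddCommGroup V) (_ : Module K V) (π : L →ₗ⁅K⁆ Module.End K V),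
    Module.Finite K V ∧ Module.finrank K V = d ∧ Function.Injective π ∧
      ∀ x : L, IsNilpotent (π x)}

end Representations

/-! Lower bounds: let `c` be the span of `Z` and the abelian summand, let `M` be a nilpotent module
of dimension `d`, and let `D = ⁅L, M⁆`, of dimension `k`. By a Nakayama argument a central element
is determined on `M` by its values on lifts of a basis of `M / D`. If `Z w ≠ 0`, the elements of the
`2m`-dimensional space of `x, y` coordinates that send `w` into `c w` form an isotropic subspace, so
`dim (c w) ≤ k - m`. Such `w` span `M` once one exists, so the image of `c` has dimension at most
`(d - k)(k - m) ≤ (d - m)² / 4` (`four_mul_finrank_central_le_of_ne_zero`). Faithfulness makes this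
image `(n + 1)`-dimensional.

For arbitrary representations, pass to the algebraic closure and split into generalized weight
spaces. Each becomes nilpotent after subtracting its weight, and the weight accounts for at most one
further dimension of `c`. For `m > 0` some component has `Z` acting non-trivially and saves `m`.
Summing the estimates costs only one dimension in total (`Finset.four_mul_sum_succ_le`), whence `n`
replaces `n + 1`.

Upper bounds: block triangular matrices with `Z` and the abelian part in one rectangular corner,
plus scalars when nilpotency is not required. A nearly square corner is optimal. -/

/-! ### Central elements acting on nilpotent modules. -/

section NilpotentModules

open Module

variable {F L M : Type*} [Field F] [LieRing L] [LieAlgebra F L] [AddCommGroup M] [Module F M]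
  [LieRingModule L M] [LieModule F L M]

/-- A Lie submodule which together with `⁅L, M⁆` spans a nilpotent Lie module `M` is all of
`M`. -/
theorem LieSubmodule.eq_top_of_sup_lie_eq_top [LieModule.IsNilpotent L M]
    (N : LieSubmodule F L M)
    (hN : N ⊔ ⁅(⊤ : LieIdeal F L), (⊤ : LieSubmodule F L M)⁆ = ⊤) : N = ⊤ := by
  -- Nakayama: bracketing the equality at stage `k` with `L` gives `⁅L, M⁆` inside `N` plus the next
  -- term of the series.
  have key : ∀ k, N ⊔ LieModule.lowerCentralSeries F L M k = ⊤ := by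
    intro k
    induction k with
    | zero => simp
    | succ k ih =>
      rw [LieModule.lowerCentralSeries_succ, eq_top_iff, ← hN]
      refine sup_le le_sup_left ?_
      conv_lhs => rw [← ih, LieSubmodule.lie_sup]
      exact sup_le (LieSubmodule.lie_le_right _ _ |>.trans le_sup_left) le_sup_right
  obtain ⟨k, hk⟩ := LieModule.IsNilpotent.nilpotent F L M
  simpa [hk] using key k

/-- The linear map `x ↦ ⁅x, w⁆`. -/
abbrev LieModule.evalAt (F L : Type*) {M : Type*} [Field F] [LieRing L] [LieAlgebra F L]
    [AddCommGroup M] [Module F M] [LieRingModule L M] [LieModule F L M] (w : M) : L →ₗ[F] M :=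
  (LieModule.toEnd F L M : L →ₗ[F] Module.End F M).flip w

variable [Module.Finite F M]

/-- The kernel of a central element is a submodule, so the element vanishes once it kills lifts of a
basis of `M / ⁅L, M⁆`. The lifts can be drawn from any spanning set `S`, so `e` need only bound the
orbits of vectors in `S`. -/
theorem finrank_map_toEnd_le [LieModule.IsNilpotent L M] (c : Submodule F L)
    (hc : ∀ z ∈ c, ∀ x : L, ⁅z, x⁆ = 0) (S : Set M) (hS : Submodule.span F S = ⊤) (e : ℕ)
    (he : ∀ w ∈ S, finrank F (c.map (LieModule.evalAt F L w)) ≤ e) :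
    finrank F (c.map (LieModule.toEnd F L M : L →ₗ[F] Module.End F M)) ≤
      (finrank F M -
        finrank F ⁅(⊤ : LieIdeal F L), (⊤ : LieSubmodule F L M)⁆.toSubmodule) * e := by
  set D : Submodule F M := ⁅(⊤ : LieIdeal F L), (⊤ : LieSubmodule F L M)⁆.toSubmodule with hD
  have hspan : Submodule.span F (D.mkQ '' S) = ⊤ := by
    rw [Submodule.span_image, hS, Submodule.map_top, Submodule.range_mkQ]
  obtain ⟨f, hfS, hfspan, -⟩ := Submodule.exists_fun_fin_finrank_span_eq F (D.mkQ '' S)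
  have hq : finrank F (Submodule.span F (D.mkQ '' S)) = finrank F M - finrank F D := by
    rw [hspan, finrank_top]
    have := D.finrank_quotient_add_finrank
    omega
  replace hfspan := hfspan.trans hspan
  rw [← hq]
  generalize finrank F (Submodule.span F (D.mkQ '' S)) = q at f hfS hfspan
  choose w hwS hwf using hfS
  have hwD : Submodule.span F (Set.range w) ⊔ D = ⊤ := by
    have h1 : (Submodule.span F (Set.range w)).map D.mkQ = ⊤ := by
      rw [← Submodule.span_image, ← Set.range_comp, ← hfspan]
      congr 2
      funext i
      exact hwf i
    have := congrArg (Submodule.comap D.mkQ) h1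
    rwa [Submodule.comap_map_mkQ, Submodule.comap_top, sup_comm] at this
  let Φ : c.map (LieModule.toEnd F L M : L →ₗ[F] Module.End F M) →ₗ[F]
      ∀ i, c.map (LieModule.evalAt F L (w i)) :=
    LinearMap.pi fun i => ((LinearMap.applyₗ (w i)).restrict (by
      rintro _ ⟨z, hz, rfl⟩
      exact ⟨z, hz, rfl⟩))
  have hΦ : Function.Injective Φ := by
    rw [← LinearMap.ker_eq_bot, LinearMap.ker_eq_bot']
    rintro ⟨_, z, hz, rfl⟩ h
    have hz0 : ∀ i, ⁅z, w i⁆ = 0 := fun i => congrArg Subtype.val (congrFun h i)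
    let N : LieSubmodule F L M :=
      { LinearMap.ker (LieModule.toEnd F L M z) with
        lie_mem := by
          intro x v hv
          have hv' : ⁅z, v⁆ = 0 := hv
          change ⁅z, ⁅x, v⁆⁆ = 0
          rw [leibniz_lie, hc z hz, hv', zero_lie, lie_zero, add_zero] }
    have hN : N = ⊤ := by
      apply LieSubmodule.eq_top_of_sup_lie_eq_top
      rw [← LieSubmodule.toSubmodule_inj, LieSubmodule.sup_toSubmodule,
        LieSubmodule.top_toSubmodule, eq_top_iff, ← hwD]
      refine sup_le_sup_right (Submodule.span_le.2 ?_) _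
      rintro _ ⟨i, rfl⟩
      exact hz0 i
    ext v
    have : v ∈ N := hN ▸ LieSubmodule.mem_top v
    exact this
  calc _ ≤ finrank F (∀ i, c.map (LieModule.evalAt F L (w i))) :=
        LinearMap.finrank_le_finrank_of_injective hΦ
    _ = ∑ i, finrank F (c.map (LieModule.evalAt F L (w i))) := Module.finrank_pi_fintype F
    _ ≤ ∑ _i : Fin q, e := Finset.sum_le_sum fun i _ => he _ (hwS i)
    _ = q * e := by simp

end NilpotentModules

/-! ### Isotropic subspaces. -/

section Isotropic

open Module

/-- A subspace on which the standard symplectic form of `F ^ 2m` vanishes has dimension at most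
`m`. -/
theorem finrank_le_of_isotropic {F : Type*} [Field F] {m : ℕ}
    (I : Submodule F ((Fin m → F) × (Fin m → F)))
    (hI : ∀ a ∈ I, ∀ b ∈ I, ∑ i, (a.1 i * b.2 i - a.2 i * b.1 i) = 0) : finrank F I ≤ m := by
  let B : LinearMap.BilinForm F ((Fin m → F) × (Fin m → F)) :=
    LinearMap.mk₂ F (fun a b => ∑ i, (a.1 i * b.2 i - a.2 i * b.1 i))
      (fun a a' b => by
        rw [← Finset.sum_add_distrib]
        exact Finset.sum_congr rfl fun i _ => by simp; ring)
      (fun t a b => by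
        rw [Finset.smul_sum]
        exact Finset.sum_congr rfl fun i _ => by simp; ring)
      (fun a b b' => by
        rw [← Finset.sum_add_distrib]
        exact Finset.sum_congr rfl fun i _ => by simp; ring)
      (fun t a b => by
        rw [Finset.smul_sum]
        exact Finset.sum_congr rfl fun i _ => by simp; ring)
  have hker : LinearMap.ker B = ⊥ := by
    rw [LinearMap.ker_eq_bot']
    intro a ha
    have h1 : ∀ i, a.1 i = 0 := fun i => by
      simpa [B, Pi.single_apply] using LinearMap.congr_fun ha (0, Pi.single i 1)
    have h2 : ∀ i, a.2 i = 0 := fun i => by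
      simpa [B, Pi.single_apply] using LinearMap.congr_fun ha (Pi.single i 1, 0)
    exact Prod.ext (funext h1) (funext h2)
  -- Nondegeneracy makes the dimensions of `I` and its orthogonal add up to `2m`.
  have hle : I ≤ B.orthogonal I := fun b hb a ha => hI a ha b hb
  have h := LinearMap.BilinForm.finrank_add_finrank_orthogonal' (B := B) I
  rw [hker, inf_bot_eq, finrank_bot, Module.finrank_prod, Module.finrank_fin_fun] at h
  have := Submodule.finrank_mono hle
  omega

end Isotropic

/-! ### The quadratic bound on nilpotent modules. -/

namespace HeisenbergLie

open Module

variable (F : Type u) [Field F] (m n : ℕ)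

/-- The projection of `𝔥ₘ ⊕ 𝔞ₙ` onto the coordinates `x` and `y` of `𝔥ₘ`. -/
def projXY : (HeisenbergLie F m × AbelianLie F n) →ₗ[F] (Fin m → F) × (Fin m → F) where
  toFun a := (a.1.x, a.1.y)
  map_add' _ _ := rfl
  map_smul' _ _ := rfl

/-- The section of `projXY` with vanishing central coordinates. -/
def liftXY : (Fin m → F) × (Fin m → F) →ₗ[F] (HeisenbergLie F m × AbelianLie F n) where
  toFun a := (⟨a.1, a.2, 0⟩, 0)
  map_add' _ _ := by ext <;> simp
  map_smul' _ _ := by ext <;> simp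

/-- The parametrisation of the subspace of `𝔥ₘ ⊕ 𝔞ₙ` spanned by `Z` and `𝔞ₙ`. -/
def central : F × AbelianLie F n →ₗ[F] (HeisenbergLie F m × AbelianLie F n) where
  toFun a := (⟨0, 0, a.1⟩, a.2)
  map_add' _ _ := by ext <;> simp
  map_smul' _ _ := by ext <;> simp

@[simp] theorem projXY_apply (a : HeisenbergLie F m × AbelianLie F n) :
    projXY F m n a = (a.1.x, a.1.y) := rfl

@[simp] theorem liftXY_apply (a : (Fin m → F) × (Fin m → F)) :
    liftXY F m n a = (⟨a.1, a.2, 0⟩, 0) := rfl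

@[simp] theorem central_apply (a : F × AbelianLie F n) :
    central F m n a = (⟨0, 0, a.1⟩, a.2) := rfl

theorem central_injective : Function.Injective (central F m n) := by
  rintro ⟨a, b⟩ ⟨a', b'⟩ h
  exact Prod.ext (congrArg (fun t => t.1.z) h) (congrArg (fun t => t.2) h)

/-- The element `Z` of `𝔥ₘ ⊕ 𝔞ₙ`. -/
abbrev elemZ : HeisenbergLie F m × AbelianLie F n := central F m n (1, 0)

variable {F m n}

theorem lie_eq (a b : HeisenbergLie F m × AbelianLie F n) :
    ⁅a, b⁆ = (∑ i, (a.1.x i * b.1.y i - a.1.y i * b.1.x i)) • elemZ F m n := by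
  refine Prod.ext (HeisenbergLie.ext ?_ ?_ ?_) ?_
  · simp
  · simp
  · simp
  · simp [AbelianLie.bracket_def]

theorem central_lie (a : F × AbelianLie F n) (b : HeisenbergLie F m × AbelianLie F n) :
    ⁅central F m n a, b⁆ = 0 := by
  rw [lie_eq]
  simp

theorem liftXY_add_central (a : HeisenbergLie F m × AbelianLie F n) :
    a = liftXY F m n (projXY F m n a) + central F m n (a.1.z, a.2) := by
  refine Prod.ext (HeisenbergLie.ext ?_ ?_ ?_) ?_ <;> simp

variable {M : Type*} [AddCommGroup M] [Module F M]
  [LieRingModule (HeisenbergLie F m × AbelianLie F n) M]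
  [LieModule F (HeisenbergLie F m × AbelianLie F n) M] [Module.Finite F M]

/-- Modulo `c w`, the map `a ↦ a w` on the `2m` noncentral coordinates has isotropic kernel, so its
image in `D / c w` has dimension at least `m`. -/
theorem finrank_central_add_le (w : M) (hw : ⁅elemZ F m n, w⁆ ≠ 0) :
    finrank F ((LinearMap.range (central F m n)).map (LieModule.evalAt F _ w)) + m ≤
      finrank F ⁅(⊤ : LieIdeal F (HeisenbergLie F m × AbelianLie F n)),
        (⊤ : LieSubmodule F (HeisenbergLie F m × AbelianLie F n) M)⁆.toSubmodule := by
  set D : Submodule F M := ⁅(⊤ : LieIdeal F (HeisenbergLie F m × AbelianLie F n)),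
        (⊤ : LieSubmodule F (HeisenbergLie F m × AbelianLie F n) M)⁆.toSubmodule with hD
  set U := (LinearMap.range (central F m n)).map (LieModule.evalAt F _ w) with hU
  have hlieD : ∀ x : HeisenbergLie F m × AbelianLie F n, ⁅x, w⁆ ∈ D := fun x =>
    LieSubmodule.lie_mem_lie (LieSubmodule.mem_top x) (LieSubmodule.mem_top w)
  have hUD : U ≤ D := by
    rintro _ ⟨z, -, rfl⟩
    exact hlieD z
  let ψ : (Fin m → F) × (Fin m → F) →ₗ[F] M ⧸ U :=
    U.mkQ ∘ₗ LieModule.evalAt F _ w ∘ₗ liftXY F m n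
  have hker : finrank F (LinearMap.ker ψ) ≤ m := by
    refine finrank_le_of_isotropic _ fun a ha b hb => ?_
    have aux : ∀ a, a ∈ LinearMap.ker ψ → ∃ c, ⁅liftXY F m n a - central F m n c, w⁆ = 0 := by
      intro a ha
      have : LieModule.evalAt F _ w (liftXY F m n a) ∈ U := by
        rwa [← Submodule.ker_mkQ U, LinearMap.mem_ker]
      obtain ⟨_, ⟨c, rfl⟩, hc⟩ := this
      refine ⟨c, ?_⟩
      rw [sub_lie, sub_eq_zero]
      exact hc.symm
    obtain ⟨c, hc⟩ := aux a ha
    obtain ⟨c', hc'⟩ := aux b hb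
    -- Both corrected elements kill `w`, hence so does their bracket, a multiple of `Z` by the
    -- symplectic form.
    have h := lie_lie (liftXY F m n a - central F m n c) (liftXY F m n b - central F m n c') w
    rw [hc, hc', lie_zero, lie_zero, sub_zero, lie_eq, smul_lie] at h
    have hx : ∀ s t : HeisenbergLie F m, (s - t).x = s.x - t.x := fun _ _ => rfl
    have hy : ∀ s t : HeisenbergLie F m, (s - t).y = s.y - t.y := fun _ _ => rfl
    simpa [hx, hy] using (smul_eq_zero.1 h).resolve_right hw
  have hrange : LinearMap.range ψ ≤ D.map U.mkQ := by
    rintro _ ⟨a, rfl⟩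
    exact ⟨_, hlieD _, rfl⟩
  have h1 := Submodule.finrank_mono hrange
  have h2 := LinearMap.finrank_range_add_finrank_ker ψ
  rw [Module.finrank_prod, Module.finrank_fin_fun] at h2
  have h3 : finrank F (D.map U.mkQ) + finrank F U = finrank F D := by
    have := LinearMap.finrank_range_add_finrank_ker (U.mkQ ∘ₗ D.subtype)
    rw [LinearMap.range_comp, Submodule.range_subtype, LinearMap.ker_comp, Submodule.ker_mkQ,
      (Submodule.comapSubtypeEquivOfLe hUD).finrank_eq] at this
    exact this
  omega

/-- AM-GM for the factors `d - k` and `e`, whose sum is `d - (k - e)`. -/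
theorem four_mul_sub_mul_le {d k e : ℕ} (hk : k ≤ d) (he : e ≤ k) (b : ℕ) (hb : b ≤ (d - k) * e) :
    4 * b ≤ (d - (k - e)) ^ 2 := by
  obtain ⟨r, rfl⟩ := Nat.exists_eq_add_of_le hk
  obtain ⟨s, rfl⟩ := Nat.exists_eq_add_of_le he
  have h1 : e + s + r - (e + s - e) = e + r := by omega
  have h2 : e + s + r - (e + s) = r := by omega
  rw [h1]
  rw [h2] at hb
  nlinarith [sq_nonneg ((e : ℤ) - r), two_mul_le_add_sq e r]

theorem four_mul_finrank_central_le [LieModule.IsNilpotent (HeisenbergLie F m × AbelianLie F n) M] :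
    4 * finrank F ((LinearMap.range (central F m n)).map (LieModule.toEnd F
      (HeisenbergLie F m × AbelianLie F n) M : _ →ₗ[F] Module.End F M)) ≤ finrank F M ^ 2 := by
  have h := finrank_map_toEnd_le (F := F) (M := M) (LinearMap.range (central F m n))
    (by rintro _ ⟨a, rfl⟩ x; exact central_lie a x) Set.univ Submodule.span_univ _
    (fun w _ => Submodule.finrank_mono (by
      rintro _ ⟨z, -, rfl⟩
      exact LieSubmodule.lie_mem_lie (LieSubmodule.mem_top z) (LieSubmodule.mem_top w)))
  simpa using four_mul_sub_mul_le (Submodule.finrank_le _) le_rfl _ h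

theorem four_mul_finrank_central_le_of_ne_zero
    [LieModule.IsNilpotent (HeisenbergLie F m × AbelianLie F n) M] {v : M}
    (hv : ⁅elemZ F m n, v⁆ ≠ 0) :
    m < finrank F M ∧
    4 * finrank F ((LinearMap.range (central F m n)).map (LieModule.toEnd F
      (HeisenbergLie F m × AbelianLie F n) M : _ →ₗ[F] Module.End F M)) ≤
        (finrank F M - m) ^ 2 := by
  -- The complement of a proper subspace spans: translate a vector of the kernel by `v`.
  have hS : Submodule.span F {w : M | ⁅elemZ F m n, w⁆ ≠ 0} = ⊤ := by
    rw [eq_top_iff]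
    intro w _
    by_cases hw : ⁅elemZ F m n, w⁆ = 0
    · rw [← add_sub_cancel_right w v]
      refine sub_mem (Submodule.subset_span ?_) (Submodule.subset_span hv)
      change ⁅elemZ F m n, w + v⁆ ≠ 0
      rwa [lie_add, hw, zero_add]
    · exact Submodule.subset_span hw
  have hD := fun w hw => finrank_central_add_le (F := F) (m := m) (n := n) (M := M) w hw
  have h := finrank_map_toEnd_le (F := F) (M := M) (LinearMap.range (central F m n))
    (by rintro _ ⟨a, rfl⟩ x; exact central_lie a x) _ hS _
    (fun w hw => Nat.le_sub_of_add_le (hD w hw))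
  have hle := Submodule.finrank_le ⁅(⊤ : LieIdeal F (HeisenbergLie F m × AbelianLie F n)),
        (⊤ : LieSubmodule F (HeisenbergLie F m × AbelianLie F n) M)⁆.toSubmodule
  have hpos : 0 < finrank F
      ((LinearMap.range (central F m n)).map (LieModule.evalAt F _ v)) := by
    rw [Module.finrank_pos_iff_exists_ne_zero]
    exact ⟨⟨_, _, ⟨_, rfl⟩, rfl⟩, fun h => hv (congrArg Subtype.val h)⟩
  have hDv := hD v hv
  refine ⟨by omega, ?_⟩
  have := four_mul_sub_mul_le hle (Nat.sub_le _ m) _ h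
  rwa [Nat.sub_sub_self (by omega)] at this

end HeisenbergLie

/-- The cross term of the square absorbs the extra `4` of each new summand, so only one `4`
survives. -/
theorem Finset.four_mul_sum_succ_le {ι : Type*} (s : Finset ι) (hs : s.Nonempty) (b e : ι → ℕ)
    (he : ∀ i ∈ s, 1 ≤ e i) (hb : ∀ i ∈ s, 4 * b i ≤ e i ^ 2) :
    4 * ∑ i ∈ s, (b i + 1) ≤ (∑ i ∈ s, e i) ^ 2 + 4 ∧ 1 ≤ ∑ i ∈ s, e i := by
  induction hs using Finset.Nonempty.cons_induction with
  | singleton a =>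
    have := hb a (by simp)
    have := he a (by simp)
    simp only [Finset.sum_singleton]
    omega
  | cons a s ha hs ih =>
    obtain ⟨ih, ih'⟩ := ih (fun i hi => he i (Finset.mem_cons_of_mem hi))
      fun i hi => hb i (Finset.mem_cons_of_mem hi)
    have h1 := he a (Finset.mem_cons_self a s)
    have h2 := hb a (Finset.mem_cons_self a s)
    rw [Finset.sum_cons, Finset.sum_cons]
    generalize ∑ i ∈ s, e i = E at ih ih' ⊢
    generalize ∑ i ∈ s, (b i + 1) = B at ih ⊢
    generalize e a = x at h1 h2 ⊢
    generalize b a = y at h2 ⊢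
    refine ⟨?_, by omega⟩
    -- Here the cross term is only `2`; integrality rescues the bound, forcing `y = 0` and `B ≤ 1`.
    by_cases h : x = 1 ∧ E = 1
    · obtain ⟨rfl, rfl⟩ := h
      omega
    · have : 2 ≤ x * E := by
        rcases Nat.lt_or_ge 1 x with hx | hx
        · nlinarith
        · have : x = 1 := by omega
          subst this
          omega
      nlinarith

/-! ### Weight decomposition over an algebraically closed field. -/

namespace HeisenbergLie

open Module

variable {F : Type u} [Field F] {m n : ℕ}

instance : Module.Finite F (AbelianLie F n) := inferInstanceAs (Module.Finite F (Fin n → F))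

instance : LieRing.IsNilpotent (HeisenbergLie F m × AbelianLie F n) := by
  have : Module.Finite F (HeisenbergLie F m × AbelianLie F n) :=
    Module.Finite.of_surjective ((liftXY F m n).coprod (central F m n)) fun a =>
      ⟨(projXY F m n a, (a.1.z, a.2)), by
        rw [LinearMap.coprod_apply]
        exact (liftXY_add_central a).symm⟩
  rw [LieAlgebra.isNilpotent_iff_forall (R := F)]
  refine fun x => ⟨2, LinearMap.ext fun y => ?_⟩
  rw [pow_two, Module.End.mul_apply, LieAlgebra.ad_apply, LieAlgebra.ad_apply, lie_eq x y,
    lie_smul, ← lie_skew, central_lie, neg_zero, smul_zero, LinearMap.zero_apply]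

variable {M : Type*} [AddCommGroup M] [Module F M]
  [LieRingModule (HeisenbergLie F m × AbelianLie F n) M]
  [LieModule F (HeisenbergLie F m × AbelianLie F n) M] [Module.Finite F M]

open LieModule

theorem four_mul_le_of_isAlgClosed [IsAlgClosed F] [CharZero F]
    (h : ∀ a, (∀ v : M, ⁅central F m n a, v⁆ = 0) → a = 0) :
    m ≤ finrank F M ∧ 4 * n ≤ (finrank F M - m) ^ 2 := by
  classical
  let L := HeisenbergLie F m × AbelianLie F n
  let N : Weight F L M → Type _ := fun χ => shiftedGenWeightSpace F L M χ
  have htop := iSup_genWeightSpace_eq_top' F L M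
  have hext : ∀ a : L, (∀ χ : Weight F L M, ∀ v ∈ genWeightSpace M χ, ⁅a, v⁆ = 0) →
      ∀ v : M, ⁅a, v⁆ = 0 := by
    intro a ha v
    have hv : v ∈ (⨆ χ : Weight F L M, genWeightSpace M χ : LieSubmodule F L M).toSubmodule := by
      rw [htop]
      exact LieSubmodule.mem_top v
    rw [LieSubmodule.iSup_toSubmodule] at hv
    have hle : ⨆ χ : Weight F L M, (genWeightSpace M χ : LieSubmodule F L M).toSubmodule ≤
        LinearMap.ker (toEnd F L M a) := iSup_le fun χ v hv => ha χ v hv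
    exact hle hv
  have hsum : ∑ χ : Weight F L M, finrank F (N χ) = finrank F M := by
    have hint : DirectSum.IsInternal
        fun χ : Weight F L M => (genWeightSpace M χ : LieSubmodule F L M).toSubmodule := by
      refine DirectSum.isInternal_submodule_of_iSupIndep_of_iSup_eq_top ?_ ?_
      · rw [LieSubmodule.iSupIndep_toSubmodule]
        exact iSupIndep_genWeightSpace' F L M
      · rw [← LieSubmodule.iSup_toSubmodule, htop, LieSubmodule.top_toSubmodule]
    rw [← (LinearEquiv.ofBijective (DirectSum.coeLinearMap _) hint).finrank_eq, finrank_directSum]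
    rfl
  let b : Weight F L M → ℕ := fun χ =>
    finrank F ((LinearMap.range (central F m n)).map (toEnd F L (N χ) : L →ₗ[F] Module.End F (N χ)))
  have hcount : n + 1 ≤ ∑ χ, (b χ + 1) := by
    -- On each weight space, a central element is recovered from its shifted action together with
    -- its weight.
    let T : F × AbelianLie F n →ₗ[F] ∀ χ : Weight F L M,
        ((LinearMap.range (central F m n)).map
          (toEnd F L (N χ) : L →ₗ[F] Module.End F (N χ))) × F :=
      LinearMap.pi fun χ => LinearMap.prod
        (((toEnd F L (N χ) : L →ₗ[F] Module.End F (N χ)) ∘ₗ central F m n).codRestrict _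
          fun a => ⟨_, ⟨a, rfl⟩, rfl⟩)
        (χ.toLinear ∘ₗ central F m n)
    have hT : Function.Injective T := by
      rw [← LinearMap.ker_eq_bot, LinearMap.ker_eq_bot']
      intro a ha
      refine h a (hext _ fun χ v hv => ?_)
      have h1 : toEnd F L (N χ) (central F m n a) = 0 :=
        congrArg Subtype.val (congrArg Prod.fst (congrFun ha χ))
      have h2 : χ (central F m n a) = 0 := congrArg Prod.snd (congrFun ha χ)
      have h3 := congrArg Subtype.val (LinearMap.congr_fun h1 (⟨v, hv⟩ : N χ))
      rw [toEnd_apply_apply, shiftedGenWeightSpace.coe_lie_shiftedGenWeightSpace_apply, h2, zero_smul, sub_zero] at h3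
      exact h3
    have h1 := LinearMap.finrank_le_finrank_of_injective hT
    have h2 : finrank F (AbelianLie F n) = n := Module.finrank_fin_fun F
    rw [Module.finrank_prod, finrank_self, h2, Module.finrank_pi_fintype] at h1
    simp only [Module.finrank_prod, finrank_self] at h1
    rwa [add_comm 1 n] at h1
  have hne : (Finset.univ : Finset (Weight F L M)).Nonempty := by
    by_contra hne
    rw [Finset.not_nonempty_iff_eq_empty.1 hne] at hcount
    simp at hcount
  obtain ⟨e, he, hbe, hed⟩ : ∃ e : Weight F L M → ℕ, (∀ χ, 1 ≤ e χ) ∧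
      (∀ χ, 4 * b χ ≤ e χ ^ 2) ∧ ∑ χ, e χ + m = finrank F M := by
    have hpos : ∀ χ : Weight F L M, 1 ≤ finrank F (N χ) := fun χ =>
      zero_lt_finrank_genWeightSpace χ.genWeightSpace_ne_bot
    have hb : ∀ χ : Weight F L M, 4 * b χ ≤ finrank F (N χ) ^ 2 := fun χ =>
      four_mul_finrank_central_le
    -- For `m = 0` the element `Z` is not a bracket and may act by nonzero scalars, but there is
    -- nothing to save.
    rcases Nat.eq_zero_or_pos m with rfl | hm
    · exact ⟨fun χ => finrank F (N χ), hpos, hb, hsum⟩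
    · obtain ⟨χ₀, v, hv⟩ : ∃ χ : Weight F L M, ∃ v : N χ, ⁅elemZ F m n, v⁆ ≠ 0 := by
        by_contra! hcon
        have := h (1, 0) (hext _ fun χ v hv => ?_)
        · exact one_ne_zero (congrArg Prod.fst this)
        · have h3 := congrArg Subtype.val (hcon χ ⟨v, hv⟩)
          have h4 : χ (elemZ F m n) = 0 := by
            have := χ.apply_lie ((⟨Pi.single ⟨0, hm⟩ 1, 0, 0⟩, 0) : L)
              (⟨0, Pi.single ⟨0, hm⟩ 1, 0⟩, 0)
            rw [lie_eq] at this
            simpa [Pi.single_apply] using this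
          rw [shiftedGenWeightSpace.coe_lie_shiftedGenWeightSpace_apply, h4, zero_smul, sub_zero] at h3
          exact h3
      obtain ⟨h1, h2⟩ := four_mul_finrank_central_le_of_ne_zero hv
      -- The saving of `m` is taken at a single weight where `Z` acts nontrivially.
      refine ⟨Function.update (fun χ => finrank F (N χ)) χ₀ (finrank F (N χ₀) - m), ?_, ?_, ?_⟩
      · intro χ
        rcases eq_or_ne χ χ₀ with rfl | hχ
        · rw [Function.update_self]
          exact Nat.le_sub_of_add_le (by rw [add_comm]; exact h1)
        · rw [Function.update_of_ne hχ]
          exact hpos χ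
      · intro χ
        rcases eq_or_ne χ χ₀ with rfl | hχ
        · rwa [Function.update_self]
        · rw [Function.update_of_ne hχ]
          exact hb χ
      · rw [← hsum, Finset.sum_update_of_mem (Finset.mem_univ _),
          Finset.sum_eq_add_sum_sdiff_singleton_of_mem (Finset.mem_univ χ₀)]
        have : m ≤ finrank F (N χ₀) := h1.le
        omega
  have key := (Finset.four_mul_sum_succ_le Finset.univ hne b e (fun χ _ => he χ)
    fun χ _ => hbe χ).1
  have : finrank F M - m = ∑ χ, e χ := by omega
  rw [this]
  omega

end HeisenbergLie

/-! ### Linear independence and extension of scalars. -/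

section LinearAlgebraHelpers

open Module

/-- The linear combinations of a family of `n + 1` vectors, with coefficients in `K × 𝔞ₙ`. -/
def AbelianLie.combination {K : Type u} [Field K] {n : ℕ} {H : Type*} [AddCommGroup H] [Module K H]
    (v : Fin (n + 1) → H) : K × AbelianLie K n →ₗ[K] H :=
  Fintype.linearCombination K v ∘ₗ
    ((Fin.consLinearEquiv K fun _ : Fin (n + 1) => K) : K × (Fin n → K) →ₗ[K] (Fin (n + 1) → K))

section

variable {K : Type u} [Field K] {n : ℕ} {H : Type*} [AddCommGroup H] [Module K H]

theorem AbelianLie.combination_apply (v : Fin (n + 1) → H) (a : K × AbelianLie K n) :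
    AbelianLie.combination v a = a.1 • v 0 + ∑ j : Fin n, a.2 j • v j.succ := by
  change ∑ i, Fin.cons (α := fun _ => K) a.1 a.2 i • v i = _
  rw [Fin.sum_univ_succ]
  rfl

theorem AbelianLie.combination_one (v : Fin (n + 1) → H) :
    AbelianLie.combination v (1, (0 : AbelianLie K n)) = v 0 := by
  rw [AbelianLie.combination_apply, one_smul]
  exact (congrArg _ (Finset.sum_eq_zero fun j _ => zero_smul K _)).trans (add_zero _)

theorem AbelianLie.combination_injective {v : Fin (n + 1) → H} (hv : LinearIndependent K v) :
    Function.Injective (AbelianLie.combination (K := K) v) :=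
  (linearIndependent_iff_injective_fintypeLinearCombination.1 hv).comp (LinearEquiv.injective _)

theorem exists_linearIndependent_fin_succ_of_ne_zero [Module.Finite K H] {e : H} (he : e ≠ 0)
    (k : ℕ) (hk : k < finrank K H) :
    ∃ v : Fin (k + 1) → H, LinearIndependent K v ∧ v 0 = e := by
  induction k with
  | zero => exact ⟨fun _ => e, LinearIndependent.of_subsingleton (ι := Fin 1) 0 he, rfl⟩
  | succ k ih =>
    obtain ⟨v, hv, hv0⟩ := ih (by omega)
    obtain ⟨x, hx⟩ := exists_linearIndependent_snoc_of_lt_finrank hv hk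
    exact ⟨_, hx, by rw [← hv0, ← Fin.castSucc_zero, Fin.snoc_castSucc]⟩

/-- Map matrix entries into `F`; linear independence of vectors survives field extension. -/
theorem exists_ringHom_end_linearIndependent (F : Type*) [Field F] [Algebra K F] (V : Type*)
    [AddCommGroup V] [Module K V] [Module.Finite K V] :
    ∃ r : Module.End K V →+* Module.End F (Fin (finrank K V) → F),
      ∀ (k : ℕ) (v : Fin k → Module.End K V), LinearIndependent K v →
        LinearIndependent F fun i => r (v i) := by
  let t := LinearMap.toMatrixAlgEquiv (finBasis K V)
  let s := Matrix.toLinAlgEquiv' (R := F) (n := Fin (finrank K V))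
  refine ⟨(s : _ →+* Module.End F (Fin (finrank K V) → F)).comp
    ((algebraMap K F).mapMatrix.comp (t : Module.End K V →+*
      Matrix (Fin (finrank K V)) (Fin (finrank K V)) K)), fun k v hv => ?_⟩
  have h1 : LinearIndependent K fun i =>
      (LinearEquiv.curry K K (Fin (finrank K V)) (Fin (finrank K V))).symm (t (v i)) :=
    (hv.map' t.toLinearEquiv.toLinearMap (LinearEquiv.ker _)).map'
      (LinearEquiv.curry K K (Fin (finrank K V)) (Fin (finrank K V))).symm.toLinearMap
      (LinearEquiv.ker _)
  have h2 := (linearIndependent_algebraMap_comp_iff (S := F)).2 h1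
  have h3 := (h2.map' (LinearEquiv.curry F F (Fin (finrank K V)) (Fin (finrank K V))).toLinearMap
      (LinearEquiv.ker _)).map' s.toLinearEquiv.toLinearMap (LinearEquiv.ker _)
  exact h3

end

end LinearAlgebraHelpers

/-! ### Lower bounds for faithful representations. -/

section Representations

open Module

attribute [local instance 100] LieRing.ofAssociativeRing

namespace HeisenbergLie

variable {F : Type u} [Field F] {m n : ℕ}

variable (F m n) in
/-- The coordinates of an element of `𝔥ₘ ⊕ 𝔞ₙ` with respect to `Z` and the basis of `𝔞ₙ`. -/
def centralCoord : (HeisenbergLie F m × AbelianLie F n) →ₗ[F] F × AbelianLie F n where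
  toFun a := (a.1.z, a.2)
  map_add' _ _ := rfl
  map_smul' _ _ := rfl

@[simp] theorem centralCoord_apply (a : HeisenbergLie F m × AbelianLie F n) :
    centralCoord F m n a = (a.1.z, a.2) := rfl

/-- This transports a representation to a larger field through the images of basis elements, with no
tensor product of Lie algebras; `C 0` plays the role of `Z`. -/
theorem exists_hom_of_relations {B : Type*} [LieRing B] [LieAlgebra F B] (X Y : Fin m → B)
    (C : Fin (n + 1) → B) (hXX : ∀ i j, ⁅X i, X j⁆ = 0) (hYY : ∀ i j, ⁅Y i, Y j⁆ = 0)
    (hXY : ∀ i j, ⁅X i, Y j⁆ = if i = j then C 0 else 0)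
    (hCX : ∀ k i, ⁅C k, X i⁆ = 0) (hCY : ∀ k i, ⁅C k, Y i⁆ = 0) (hCC : ∀ k l, ⁅C k, C l⁆ = 0) :
    ∃ π : (HeisenbergLie F m × AbelianLie F n) →ₗ⁅F⁆ B,
      ∀ a, π (central F m n a) = AbelianLie.combination C a := by
  let f : (HeisenbergLie F m × AbelianLie F n) →ₗ[F] B :=
    (Fintype.linearCombination F X).coprod (Fintype.linearCombination F Y) ∘ₗ projXY F m n +
      AbelianLie.combination C ∘ₗ centralCoord F m n
  have hf : ∀ a, f a = ∑ i, a.1.x i • X i + ∑ i, a.1.y i • Y i +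
      (a.1.z • C 0 + ∑ j : Fin n, a.2 j • C j.succ) := fun a => by
    simp [f, AbelianLie.combination_apply, Fintype.linearCombination_apply]
  have hXC : ∀ i k, ⁅X i, C k⁆ = 0 := fun i k => by rw [← lie_skew, hCX, neg_zero]
  have hYC : ∀ i k, ⁅Y i, C k⁆ = 0 := fun i k => by rw [← lie_skew, hCY, neg_zero]
  have hYX : ∀ i j, ⁅Y i, X j⁆ = if i = j then -C 0 else 0 := fun i j => by
    rw [← lie_skew, hXY]
    by_cases h : i = j
    · simp [h]
    · simp [h, Ne.symm h]
  have hlie : ∀ a b, f ⁅a, b⁆ = ⁅f a, f b⁆ := fun a b => by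
    have hZ : f (elemZ F m n) = C 0 := by
      simp [f, AbelianLie.combination_one]
    rw [lie_eq a b, map_smul, hZ, hf a, hf b]
    simp only [lie_add, add_lie, lie_sum, sum_lie, lie_smul, smul_lie, hXX, hYY, hXY, hCX, hCY,
      hCC, hXC, hYC, hYX, smul_zero, Finset.sum_const_zero, add_zero, zero_add, smul_ite,
      Finset.sum_ite_eq', Finset.mem_univ, if_true, smul_neg]
    rw [Finset.sum_smul, ← Finset.sum_add_distrib]
    refine Finset.sum_congr rfl fun i _ => ?_
    module
  exact ⟨{ f with map_lie' := hlie _ _ }, fun a => by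
    change f _ = _
    simp [f]⟩

theorem le_of_mem_faithfulNilrepDims {d : ℕ}
    (hd : d ∈ faithfulNilrepDims F (HeisenbergLie F m × AbelianLie F n)) :
    m ≤ d ∧ 4 * (n + 1) ≤ (d - m) ^ 2 := by
  obtain ⟨V, _, _, π, _, rfl, hinj, hnil⟩ := hd
  let _ : LieRingModule (HeisenbergLie F m × AbelianLie F n) V := LieRingModule.compLieHom V π
  have : LieModule F (HeisenbergLie F m × AbelianLie F n) V := LieModule.compLieHom V π
  -- Engel's theorem.
  have : LieModule.IsNilpotent (HeisenbergLie F m × AbelianLie F n) V :=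
    (LieModule.isNilpotent_iff_forall' (R := F)).2 hnil
  obtain ⟨v, hv⟩ : ∃ v : V, ⁅elemZ F m n, v⁆ ≠ 0 := by
    by_contra! h
    have h0 : elemZ F m n = 0 := hinj (by rw [map_zero]; exact LinearMap.ext h)
    have := central_injective F m n (h0.trans (map_zero (central F m n)).symm)
    exact one_ne_zero (congrArg Prod.fst this)
  obtain ⟨h1, h2⟩ := four_mul_finrank_central_le_of_ne_zero hv
  refine ⟨h1.le, ?_⟩
  have h3 : finrank F (AbelianLie F n) = n := Module.finrank_fin_fun F
  change 4 * finrank F ((LinearMap.range (central F m n)).map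
    (π : (HeisenbergLie F m × AbelianLie F n) →ₗ[F] Module.End F V)) ≤ _ at h2
  have hinj' : Function.Injective ((π : (HeisenbergLie F m × AbelianLie F n) →ₗ[F]
      Module.End F V) ∘ₗ central F m n) := fun a b hab => central_injective F m n (hinj hab)
  rwa [← LinearMap.range_comp, LinearMap.finrank_range_of_inj hinj', Module.finrank_prod, finrank_self, h3,
    add_comm 1 n] at h2

theorem le_of_mem_faithfulRepDims [CharZero F] {d : ℕ}
    (hd : d ∈ faithfulRepDims F (HeisenbergLie F m × AbelianLie F n)) :
    m ≤ d ∧ 4 * n ≤ (d - m) ^ 2 := by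
  obtain ⟨V, _, _, π, _, rfl, hinj⟩ := hd
  obtain ⟨r, hr⟩ := exists_ringHom_end_linearIndependent (K := F) (AlgebraicClosure F) V
  have hlie : ∀ a b, ⁅r (π a), r (π b)⁆ = r (π ⁅a, b⁆) := fun a b => by
    rw [LieHom.map_lie, LieRing.of_associative_ring_bracket, LieRing.of_associative_ring_bracket,
      map_sub, map_mul, map_mul]
  let X : Fin m → HeisenbergLie F m × AbelianLie F n := fun i => liftXY F m n (Pi.single i 1, 0)
  let Y : Fin m → HeisenbergLie F m × AbelianLie F n := fun i => liftXY F m n (0, Pi.single i 1)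
  let c : Fin (n + 1) → F × AbelianLie F n :=
    fun k => (Fin.consLinearEquiv F fun _ : Fin (n + 1) => F).symm (Pi.single k 1)
  let C : Fin (n + 1) → HeisenbergLie F m × AbelianLie F n := fun k => central F m n (c k)
  have hc0 : c 0 = (1, 0) := (LinearEquiv.symm_apply_eq _).2 <| funext fun k => by
    refine Fin.cases ?_ (fun j => ?_) k
    · rw [Pi.single_eq_same]
      rfl
    · rw [Pi.single_eq_of_ne (Fin.succ_ne_zero j)]
      rfl
  have hC0 : C 0 = elemZ F m n := congrArg (central F m n) hc0
  have hzero : ∀ a b : HeisenbergLie F m × AbelianLie F n, ⁅a, b⁆ = 0 → ⁅r (π a), r (π b)⁆ = 0 :=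
    fun a b h => by rw [hlie, h, map_zero, map_zero]
  obtain ⟨ρ, hρ⟩ := exists_hom_of_relations (F := AlgebraicClosure F) (fun i => r (π (X i)))
    (fun i => r (π (Y i))) (fun k => r (π (C k)))
    (fun i j => hzero _ _ (by rw [lie_eq]; simp [X]))
    (fun i j => hzero _ _ (by rw [lie_eq]; simp [Y]))
    (fun i j => by
      rw [hlie, lie_eq, hC0]
      by_cases h : i = j
      · simp [X, Y, h, Pi.single_apply]
      · simp [X, Y, h, Ne.symm h, Pi.single_apply])
    (fun k i => hzero _ _ (central_lie _ _)) (fun k i => hzero _ _ (central_lie _ _))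
    (fun k i => hzero _ _ (central_lie _ _))
  have hCind : LinearIndependent F C := by
    have h1 : LinearIndependent F (fun k : Fin (n + 1) => (Pi.single k 1 : Fin (n + 1) → F)) :=
      Pi.linearIndependent_single_one _ _
    exact (h1.map' (Fin.consLinearEquiv F fun _ : Fin (n + 1) => F).symm.toLinearMap
      (LinearEquiv.ker _)).map' (central F m n)
        (LinearMap.ker_eq_bot.2 (central_injective F m n))
  -- Only injectivity on the central span is carried to the closure; the weight argument needs no
  -- more.
  have hind := hr _ _ (hCind.map' (π : _ →ₗ[F] Module.End F V) (LinearMap.ker_eq_bot.2 hinj))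
  let _ : LieRingModule (HeisenbergLie (AlgebraicClosure F) m × AbelianLie (AlgebraicClosure F) n)
    (Fin (finrank F V) → AlgebraicClosure F) := LieRingModule.compLieHom _ ρ
  have : LieModule (AlgebraicClosure F)
    (HeisenbergLie (AlgebraicClosure F) m × AbelianLie (AlgebraicClosure F) n)
    (Fin (finrank F V) → AlgebraicClosure F) := LieModule.compLieHom _ ρ
  have := four_mul_le_of_isAlgClosed (F := AlgebraicClosure F) (m := m) (n := n)
    (M := Fin (finrank F V) → AlgebraicClosure F) fun a ha => by
      have h0 : ρ (central _ m n a) = 0 := LinearMap.ext ha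
      rw [hρ] at h0
      exact AbelianLie.combination_injective hind (h0.trans (map_zero _).symm)
  rwa [Module.finrank_fin_fun] at this

end HeisenbergLie

end Representations

/-! ### Block matrix representations attaining the bounds. -/

section Representations

open Module

attribute [local instance 100] LieRing.ofAssociativeRing

namespace HeisenbergLie

variable {K : Type u} [Field K] {m n : ℕ}

/-- The operator `(u, t, v) ↦ (s u, u₀ y + s t, (x ⬝ t) e₀ + B u + s v)`. -/
def blockOperator {p q : ℕ} :
    (((Fin m → K) × (Fin m → K)) × (((Fin (q + 1) → K) →ₗ[K] (Fin (p + 1) → K)) × K)) →ₗ[K]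
      Module.End K ((Fin (q + 1) → K) × (Fin m → K) × (Fin (p + 1) → K)) :=
  LinearMap.mk₂ K
    (fun a w => (a.2.2 • w.1, w.1 0 • a.1.2 + a.2.2 • w.2.1,
      (∑ i, a.1.1 i * w.2.1 i) • Pi.single 0 1 + a.2.1 w.1 + a.2.2 • w.2.2))
    (fun a b w => by
      have : ∑ i, (a.1.1 i + b.1.1 i) * w.2.1 i =
          ∑ i, a.1.1 i * w.2.1 i + ∑ i, b.1.1 i * w.2.1 i := by
        simp only [add_mul, Finset.sum_add_distrib]
      refine Prod.ext ?_ (Prod.ext ?_ ?_) <;> simp [this] <;> module)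
    (fun t a w => by
      have : ∑ i, (t * a.1.1 i) * w.2.1 i = t * ∑ i, a.1.1 i * w.2.1 i := by
        simp only [mul_assoc, Finset.mul_sum]
      refine Prod.ext ?_ (Prod.ext ?_ ?_) <;> simp [this] <;> module)
    (fun a w w' => by
      have : ∑ i, a.1.1 i * (w.2.1 i + w'.2.1 i) =
          ∑ i, a.1.1 i * w.2.1 i + ∑ i, a.1.1 i * w'.2.1 i := by
        simp only [mul_add, Finset.sum_add_distrib]
      refine Prod.ext ?_ (Prod.ext ?_ ?_) <;> simp [this] <;> module)
    (fun t a w => by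
      have : ∑ i, a.1.1 i * (t * w.2.1 i) = t * ∑ i, a.1.1 i * w.2.1 i := by
        simp only [Finset.mul_sum, mul_left_comm]
      refine Prod.ext ?_ (Prod.ext ?_ ?_) <;> simp [this] <;> module)

theorem blockOperator_apply {p q : ℕ}
    (a : ((Fin m → K) × (Fin m → K)) × (((Fin (q + 1) → K) →ₗ[K] (Fin (p + 1) → K)) × K))
    (w : (Fin (q + 1) → K) × (Fin m → K) × (Fin (p + 1) → K)) :
    blockOperator a w = (a.2.2 • w.1, w.1 0 • a.1.2 + a.2.2 • w.2.1,
      (∑ i, a.1.1 i * w.2.1 i) • Pi.single 0 1 + a.2.1 w.1 + a.2.2 • w.2.2) := rfl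

theorem blockOperator_injective {p q : ℕ} :
    Function.Injective (blockOperator (K := K) (m := m) (p := p) (q := q)) := by
  rw [← LinearMap.ker_eq_bot, LinearMap.ker_eq_bot']
  rintro ⟨⟨x, y⟩, B, s⟩ h
  have hw : ∀ w, _ = _ := fun w => LinearMap.congr_fun h w
  simp only [blockOperator_apply, LinearMap.zero_apply, Prod.mk_eq_zero] at hw
  have hs : s = 0 := by simpa using congrFun (hw (Pi.single 0 1, 0, 0)).1 0
  subst hs
  have hy : y = 0 := by simpa using (hw (Pi.single 0 1, 0, 0)).2.1
  have hx : x = 0 := funext fun i => by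
    simpa [Pi.single_apply] using congrFun (hw (0, Pi.single i 1, 0)).2.2 0
  have hB : B = 0 := LinearMap.ext fun u => by simpa using (hw (u, 0, 0)).2.2
  rw [hx, hy, hB]
  rfl

/-- The element of `Hom(K ^ (q + 1), K ^ (p + 1))` with a single non-zero matrix entry, in the
upper left corner. -/
def cornerHom (K : Type u) [Field K] (p q : ℕ) : (Fin (q + 1) → K) →ₗ[K] (Fin (p + 1) → K) :=
  (LinearMap.proj 0).smulRight (Pi.single 0 1)

theorem cornerHom_apply (p q : ℕ) (u : Fin (q + 1) → K) :
    cornerHom K p q u = u 0 • Pi.single 0 1 := rfl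

theorem cornerHom_ne_zero (p q : ℕ) : cornerHom K p q ≠ 0 := fun h => by
  simpa [cornerHom_apply] using congrFun (LinearMap.congr_fun h (Pi.single 0 1)) 0

/-- The representation of `𝔥ₘ ⊕ 𝔞ₙ` on `K ^ (q + 1) × K ^ m × K ^ (p + 1)` with prescribed action of
`Z` and `𝔞ₙ`. -/
def blockRep {p q : ℕ}
    (β : K × AbelianLie K n →ₗ[K] ((Fin (q + 1) → K) →ₗ[K] (Fin (p + 1) → K)) × K)
    (hβ : β (1, 0) = (cornerHom K p q, 0)) :
    (HeisenbergLie K m × AbelianLie K n) →ₗ⁅K⁆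
      Module.End K ((Fin (q + 1) → K) × (Fin m → K) × (Fin (p + 1) → K)) where
  toLinearMap := blockOperator ∘ₗ (projXY K m n).prod (β ∘ₗ centralCoord K m n)
  map_lie' := by
    intro a b
    change blockOperator (projXY K m n ⁅a, b⁆, β (centralCoord K m n ⁅a, b⁆)) =
      ⁅blockOperator (projXY K m n a, β (centralCoord K m n a)),
        blockOperator (projXY K m n b, β (centralCoord K m n b))⁆
    have hc : β (centralCoord K m n ⁅a, b⁆) =
        (∑ i, (a.1.x i * b.1.y i - a.1.y i * b.1.x i)) • (cornerHom K p q, (0 : K)) := by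
      rw [lie_eq, map_smul, map_smul, ← hβ]
      rfl
    have hp : projXY K m n ⁅a, b⁆ = 0 := rfl
    rw [hc, hp]
    generalize β (centralCoord K m n a) = s
    generalize β (centralCoord K m n b) = t
    refine LinearMap.ext fun w => ?_
    rw [LieRing.of_associative_ring_bracket, LinearMap.sub_apply, Module.End.mul_apply,
      Module.End.mul_apply]
    have h1 : ∀ (x y v : Fin m → K) (c d : K), ∑ i, x i * (c * y i + d * v i) =
        c * ∑ i, x i * y i + d * ∑ i, x i * v i := fun x y v c d => by
      rw [Finset.mul_sum, Finset.mul_sum, ← Finset.sum_add_distrib]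
      exact Finset.sum_congr rfl fun i _ => by ring
    have h2 : ∑ i, b.1.x i * a.1.y i = ∑ i, a.1.y i * b.1.x i :=
      Finset.sum_congr rfl fun i _ => mul_comm _ _
    refine Prod.ext ?_ (Prod.ext ?_ ?_)
    · simp [blockOperator_apply, smul_smul, mul_comm]
    · simp [blockOperator_apply]
      module
    · simp [blockOperator_apply, cornerHom_apply, h1, h2]
      module

theorem blockRep_apply {p q : ℕ}
    (β : K × AbelianLie K n →ₗ[K] ((Fin (q + 1) → K) →ₗ[K] (Fin (p + 1) → K)) × K)
    (hβ : β (1, 0) = (cornerHom K p q, 0)) (a : HeisenbergLie K m × AbelianLie K n) :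
    blockRep β hβ a = blockOperator (projXY K m n a, β (centralCoord K m n a)) := rfl

theorem blockRep_injective {p q : ℕ}
    {β : K × AbelianLie K n →ₗ[K] ((Fin (q + 1) → K) →ₗ[K] (Fin (p + 1) → K)) × K}
    (hβ : β (1, 0) = (cornerHom K p q, 0)) (hinj : Function.Injective β) :
    Function.Injective (blockRep (m := m) β hβ) := fun a b h => by
  rw [blockRep_apply, blockRep_apply] at h
  obtain ⟨h1, h2⟩ := Prod.ext_iff.1 (blockOperator_injective h)
  have h3 := hinj h2
  rw [liftXY_add_central a, liftXY_add_central b]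
  exact congrArg₂ (fun s t => liftXY K m n s + central K m n t) h1 h3

theorem isNilpotent_blockOperator {p q : ℕ} (a : (Fin m → K) × (Fin m → K))
    (B : (Fin (q + 1) → K) →ₗ[K] (Fin (p + 1) → K)) :
    IsNilpotent (blockOperator (a, (B, (0 : K)))) :=
  -- With zero scalar part the operator is strictly triangular for the three blocks.
  ⟨3, LinearMap.ext fun w => by
    simp [pow_succ, blockOperator_apply]⟩

theorem finrank_block (p q : ℕ) :
    finrank K ((Fin (q + 1) → K) × (Fin m → K) × (Fin (p + 1) → K)) = m + (q + 1 + (p + 1)) := by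
  simp only [Module.finrank_prod, Module.finrank_fin_fun]
  omega

theorem finrank_blockHom (p q : ℕ) :
    finrank K ((Fin (q + 1) → K) →ₗ[K] (Fin (p + 1) → K)) = (q + 1) * (p + 1) := by
  rw [Module.finrank_linearMap, Module.finrank_fin_fun, Module.finrank_fin_fun]

theorem mem_faithfulNilrepDims {p q : ℕ} (h : n + 1 ≤ (q + 1) * (p + 1)) :
    m + (q + 1 + (p + 1)) ∈ faithfulNilrepDims K (HeisenbergLie K m × AbelianLie K n) := by
  obtain ⟨v, hv, hv0⟩ := exists_linearIndependent_fin_succ_of_ne_zero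
    (cornerHom_ne_zero (K := K) p q) n (by rwa [finrank_blockHom])
  let β := LinearMap.inl K ((Fin (q + 1) → K) →ₗ[K] (Fin (p + 1) → K)) K ∘ₗ
    AbelianLie.combination (K := K) v
  have hβ : β (1, 0) = (cornerHom K p q, 0) := by
    rw [LinearMap.comp_apply, AbelianLie.combination_one, hv0]
    rfl
  exact ⟨_, _, _, blockRep β hβ, inferInstance, finrank_block p q, blockRep_injective hβ
    (LinearMap.inl_injective.comp (AbelianLie.combination_injective hv)),
    fun a => isNilpotent_blockOperator _ _⟩

/-- Scalars supply one dimension beyond the corner, so the `n + 1` central directions fit. -/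
theorem mem_faithfulRepDims {p q : ℕ} (h : n ≤ (q + 1) * (p + 1)) :
    m + (q + 1 + (p + 1)) ∈ faithfulRepDims K (HeisenbergLie K m × AbelianLie K n) := by
  obtain ⟨v, hv, hv0⟩ := exists_linearIndependent_fin_succ_of_ne_zero
    (K := K) (e := (cornerHom K p q, (0 : K)))
    (fun h => cornerHom_ne_zero p q (congrArg Prod.fst h)) n (by
      rw [Module.finrank_prod, finrank_blockHom, finrank_self]
      omega)
  exact ⟨_, _, _, blockRep (AbelianLie.combination (K := K) v)
    ((AbelianLie.combination_one v).trans hv0), inferInstance, finrank_block p q,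
    blockRep_injective _ (AbelianLie.combination_injective hv)⟩

end HeisenbergLie

end Representations

/-! ### Ceilings of square roots and the conclusion. -/

theorem Nat.ceil_two_mul_sqrt_le {k d : ℕ} (h : 4 * k ≤ d ^ 2) : ⌈2 * Real.sqrt (k : ℝ)⌉₊ ≤ d := by
  rw [Nat.ceil_le, ← Real.sqrt_sq (Nat.cast_nonneg d : (0 : ℝ) ≤ d),
    show (2 : ℝ) = Real.sqrt (2 ^ 2) by rw [Real.sqrt_sq (by norm_num)],
    ← Real.sqrt_mul (by norm_num)]
  refine Real.sqrt_le_sqrt ?_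
  norm_num
  exact_mod_cast h

/-- Split the ceiling `s` into halves as equal as possible: their product is `⌊s² / 4⌋`, which is at
least `k` since `4k ≤ s²`. -/
theorem Nat.exists_ceil_two_mul_sqrt_eq {k : ℕ} (hk : 1 ≤ k) :
    ∃ p q : ℕ, k ≤ (q + 1) * (p + 1) ∧ ⌈2 * Real.sqrt (k : ℝ)⌉₊ = q + 1 + (p + 1) := by
  set s := ⌈2 * Real.sqrt (k : ℝ)⌉₊ with hs
  have h1 : 2 * Real.sqrt (k : ℝ) ≤ s := Nat.le_ceil _
  have h2 : 4 * k ≤ s ^ 2 := by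
    have h3 := Real.sq_sqrt (Nat.cast_nonneg k : (0 : ℝ) ≤ k)
    have h4 := Real.sqrt_nonneg (k : ℝ)
    have : (4 * k : ℝ) ≤ s ^ 2 := by nlinarith
    exact_mod_cast this
  have h3 : 2 ≤ s := by nlinarith
  obtain ⟨r, hr⟩ := Nat.even_or_odd' s
  rcases hr with hr | hr
  · obtain ⟨t, rfl⟩ : ∃ t, r = t + 1 := ⟨r - 1, by omega⟩
    rw [hr] at h2
    exact ⟨t, t, by nlinarith, by omega⟩
  · obtain ⟨t, rfl⟩ : ∃ t, r = t + 1 := ⟨r - 1, by omega⟩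
    rw [hr] at h2
    refine ⟨t, t + 1, ?_, by omega⟩
    ring_nf at h2 ⊢
    omega

theorem mainTheorem1 (K : Type u) [Field K] [CharZero K] (m n : ℕ) (hn : 1 ≤ n) :
    IsLeast (faithfulNilrepDims K (HeisenbergLie K m × AbelianLie K n))
        (m + ⌈2 * Real.sqrt ((n : ℝ) + 1)⌉₊) ∧
      IsLeast (faithfulRepDims K (HeisenbergLie K m × AbelianLie K n))
        (m + ⌈2 * Real.sqrt (n : ℝ)⌉₊) := by
  rw [show (n : ℝ) + 1 = ((n + 1 : ℕ) : ℝ) by push_cast; rfl]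
  refine ⟨⟨?_, fun d hd => ?_⟩, ?_, fun d hd => ?_⟩
  · obtain ⟨p, q, h, hs⟩ := Nat.exists_ceil_two_mul_sqrt_eq (k := n + 1) (by omega)
    rw [hs]
    exact HeisenbergLie.mem_faithfulNilrepDims h
  · obtain ⟨h1, h2⟩ := HeisenbergLie.le_of_mem_faithfulNilrepDims hd
    have := Nat.ceil_two_mul_sqrt_le h2
    omega
  · obtain ⟨p, q, h, hs⟩ := Nat.exists_ceil_two_mul_sqrt_eq hn
    rw [hs]
    exact HeisenbergLie.mem_faithfulRepDims h
  · obtain ⟨h1, h2⟩ := HeisenbergLie.le_of_mem_faithfulRepDims hd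
    have := Nat.ceil_two_mul_sqrt_le h2
    omega
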